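/- **Setting.** Let $\mathcal N$ be a countably infinite set of names, partitioned into sorts each of which is infinite; a *permutation* is a sort-preserving bijection of $\mathcal N$ moving only finitely many names. For an object $X$ on which permutations act, $N\subseteq\mathcal N$ *supports* $X$ if every permutation fixing $N$ pointwise fixes $X$; $\operatorname{supp}(X)$ is the least finite supporting set, if there is a finite one; $N\# X$ means $N\cap\operatorname{supp}(X)=\emptyset$. A *nominal set* is a set with a permutation action all of whose members have finite support. Write $\langle N\rangle X$ for the class of $(N,X)$ under nominal alpha-equivalence: $(N,X)=_\alpha(N',X')$ iff some permutation $\pi$ has $\pi\cdot(N,X)=(N',X')$ and fixes $\operatorname{supp}(X)\setminus N$ pointwise. A *nominal transition system* consists of nominal sets of states $P,Q$, state predicates $\varphi$ and actions $\alpha$; an equivariant relation $P\vdash\varphi$; an equivariant function $\operatorname{bn}$ from actions to finite sets of names with $\operatorname{bn}(\alpha)\subseteq\operatorname{supp}(\alpha)$; and an equivariant set of transitions $(P,\langle N\rangle(\alpha,P'))$, in each of which $N=\operatorname{bn}(\alpha)$. Write $P\xrightarrow{\alpha}P'$ if $(P,\langle\operatorname{bn}(\alpha)\rangle(\alpha,P'))$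 is a transition. Fix an action $\tau$ with empty support. Let $\Rightarrow$ be the reflexive transitive closure of $\xrightarrow{\tau}$, and let $P\stackrel{\hat\alpha}{\Rightarrow}P'$ mean $P\Rightarrow P'$ if $\alpha=\tau$, and $P\Rightarrow\circ\xrightarrow{\alpha}\circ\Rightarrow P'$ otherwise. **Weak bisimilarity.** A *weak bisimulation* is a symmetric relation $R$ on states such that $R(P,Q)$ implies (i) for all $\alpha,P'$ with $\operatorname{bn}(\alpha)\# Q$ and $P\xrightarrow{\alpha}P'$ there is $Q'$ with $Q\stackrel{\hat\alpha}{\Rightarrow}Q'$ and $R(P',Q')$; and (ii) for all $\varphi$ with $P\vdash\varphi$ there is $Q'$ with $Q\Rightarrow Q'$, $Q'\vdash\varphi$ and $R(P,Q')$. Write $P\stackrel{\cdot}{\approx}Q$ if $R(P,Q)$ for some weak bisimulation $R$. **Logic.** Fix a cardinal $\kappa>\aleph_0$ that exceeds the cardinality of the set of states. Formulas are defined inductively by $$A::=\textstyle\bigwedge_{i\in I}A_i\mid\neg A\mid\varphi\mid\langle\alpha\rangle A,$$ where $\{A_i\mid i\in I\}$ must have finite support and cardinality less than $\kappa$, and where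 in $\langle\alpha\rangle A$ the names in $\operatorname{bn}(\alpha)$ are bound (in $\alpha$ and $A$), formulas being identified up to nominal alpha-equivalence. Validity: $P\models\bigwedge_{i\in I}A_i$ iff $P\models A_i$ for all $i\in I$; $P\models\neg A$ iff not $P\models A$; $P\models\varphi$ iff $P\vdash\varphi$; and $P\models\langle\alpha\rangle A$ iff for some representative $\langle\beta\rangle B$ of $\langle\alpha\rangle A$ with $\operatorname{bn}(\beta)\# P$ there is $P'$ with $P\xrightarrow{\beta}P'$ and $P'\models B$. Let $\bigvee_{i} A_i=\neg\bigwedge_{i}\neg A_i$, let $A\wedge B$ be the conjunction of $\{A,B\}$, let $\langle\tau\rangle^0A=A$ and $\langle\tau\rangle^{i+1}A=\langle\tau\rangle\langle\tau\rangle^iA$, and put $$\langle\!\langle\tau\rangle\!\rangle A=\bigvee_{i\in\omega}\langle\tau\rangle^iA,\qquad \langle\!\langle\alpha\rangle\!\rangle A=\langle\!\langle\tau\rangle\!\rangle\langle\alpha\rangle\langle\!\langle\tau\rangle\!\rangle A\quad(\alpha\neq\tau).$$ The *weak formulas* are the formulas generated by $$A::=\textstyle\bigwedge_{i\in I}A_i\mid\neg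 A\mid\langle\!\langle\alpha\rangle\!\rangle A\mid\langle\!\langle\tau\rangle\!\rangle(A\wedge\varphi),$$ with the same conditions on conjunctions. States $P,Q$ are *weakly logically equivalent*, $P\stackrel{\cdot}{\equiv}Q$, if $P\models A\iff Q\models A$ for all weak formulas $A$. **Theorem.** For all states $P,Q$ of a nominal transition system: $P\stackrel{\cdot}{\approx}Q$ implies $P\stackrel{\cdot}{\equiv}Q$. -/

import Mathlib

open Cardinal
open scoped Pointwise

universe u

namespace NomHML

/-! ### Names, permutations and support -/

section Nominal

variable {𝒩 Srt : Type*}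

/-- The group of name permutations: sort-preserving bijections on names that move only finitely
many names. It acts on names by application. -/
def NamePerm (sort : 𝒩 → Srt) : Subgroup (Equiv.Perm 𝒩) where
  carrier := {π | (∀ a, sort (π a) = sort a) ∧ {a | π a ≠ a}.Finite}
  one_mem' := by simp
  mul_mem' := by
    rintro π ρ ⟨h1, h2⟩ ⟨h3, h4⟩
    refine ⟨fun a => by rw [Equiv.Perm.mul_apply, h1, h3], (h2.union h4).subset ?_⟩
    intro a ha
    by_contra hc
    simp only [Set.mem_union, Set.mem_ofPred_eq, not_or, not_not] at hc
    exact ha (by rw [Equiv.Perm.mul_apply, hc.2, hc.1])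
  inv_mem' := by
    rintro π ⟨h1, h2⟩
    refine ⟨fun a => by simpa using (h1 (π⁻¹ a)).symm, h2.subset ?_⟩
    intro a ha hc
    exact ha (by rw [Equiv.Perm.inv_eq_iff_eq, hc])

variable (sort : 𝒩 → Srt)

/-- The support of `x`: the intersection of all finite sets of names that support `x`. -/
def supp {X : Type*} [MulAction (NamePerm sort) X] (x : X) : Set 𝒩 :=
  {a | ∀ N : Set 𝒩, N.Finite → MulAction.Supports (NamePerm sort) N x → a ∈ N}

/-- `x` has finite support: some finite set of names supports it. -/
def FinSupp {X : Type*} [MulAction (NamePerm sort) X] (x : X) : Prop :=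
  ∃ N : Set 𝒩, N.Finite ∧ MulAction.Supports (NamePerm sort) N x

/-- `N # x`: no name in `N` belongs to the support of `x`. -/
def Fresh {X : Type*} [MulAction (NamePerm sort) X] (N : Finset 𝒩) (x : X) : Prop :=
  ∀ a ∈ N, a ∉ supp sort x

/-- A nominal set: a permutation action for which every element has finite support. -/
class Nominal (X : Type*) extends MulAction (NamePerm sort) X where
  finSupp : ∀ x : X, FinSupp sort x

variable {sort}

/-- The action of a permutation on finite sets of names. -/
def permNames (π : NamePerm sort) (N : Finset 𝒩) : Finset 𝒩 :=
  N.map π.1.toEmbedding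

theorem mem_permNames {π : NamePerm sort} {N : Finset 𝒩} {a : 𝒩} :
    a ∈ permNames π N ↔ π⁻¹ • a ∈ N := by
  simp only [permNames, Finset.mem_map_equiv]
  rfl

theorem permNames_one (N : Finset 𝒩) : permNames (1 : NamePerm sort) N = N := by
  ext a; simp [mem_permNames]

theorem permNames_mul (π ρ : NamePerm sort) (N : Finset 𝒩) :
    permNames (π * ρ) N = permNames π (permNames ρ N) := by
  ext a; simp [mem_permNames, mul_smul]

theorem mem_supp_prod {X Y : Type*} [MulAction (NamePerm sort) X] [MulAction (NamePerm sort) Y]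
    {x : X} {y : Y} {a : 𝒩} : a ∈ supp sort (x, y) ↔ a ∈ supp sort x ∨ a ∈ supp sort y := by
  constructor
  · intro h
    by_contra! hc
    obtain ⟨h1, h2⟩ := hc
    simp only [supp, Set.mem_ofPred_eq, not_forall] at h1 h2
    obtain ⟨N, hN, hs, ha⟩ := h1
    obtain ⟨M, hM, hs', hb⟩ := h2
    have := h (N ∪ M) (hN.union hM) fun σ hσ =>
      Prod.ext (hs σ fun a ha => hσ (.inl ha)) (hs' σ fun a ha => hσ (.inr ha))
    exact this.elim ha hb
  · rintro (h | h) N hN hs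
    · exact h N hN fun σ hσ => congrArg Prod.fst (hs σ hσ)
    · exact h N hN fun σ hσ => congrArg Prod.snd (hs σ hσ)

theorem supports_smul {X : Type*} [MulAction (NamePerm sort) X] (π : NamePerm sort) {x : X}
    {N : Set 𝒩} (h : MulAction.Supports (NamePerm sort) N x) :
    MulAction.Supports (NamePerm sort) (π • N) (π • x) := by
  intro σ hσ
  have : (π⁻¹ * σ * π) • x = x := h _ fun a ha => by
    rw [mul_smul, mul_smul, hσ (Set.smul_mem_smul_set ha), inv_smul_smul]
  rw [mul_smul, mul_smul, inv_smul_eq_iff] at this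
  exact this

theorem FinSupp.smul {X : Type*} [MulAction (NamePerm sort) X] (π : NamePerm sort) {x : X}
    (h : FinSupp sort x) : FinSupp sort (π • x) := by
  obtain ⟨N, hN, hs⟩ := h
  exact ⟨π • N, hN.smul_set, supports_smul π hs⟩

theorem smul_mem_supp {X : Type*} [MulAction (NamePerm sort) X] (π : NamePerm sort) {x : X}
    {a : 𝒩} (h : a ∈ supp sort x) : π • a ∈ supp sort (π • x) := by
  intro N hN hs
  have := h (π⁻¹ • N) hN.smul_set (by simpa using supports_smul π⁻¹ hs)
  rwa [Set.mem_inv_smul_set_iff] at this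

theorem mem_supp_smul {X : Type*} [MulAction (NamePerm sort) X] (π : NamePerm sort) {x : X}
    {a : 𝒩} : a ∈ supp sort (π • x) ↔ π⁻¹ • a ∈ supp sort x :=
  ⟨fun h => by simpa using smul_mem_supp π⁻¹ h, fun h => by simpa using smul_mem_supp π h⟩

/-- Nominal alpha-equivalence of pairs `(N, x)` of a finite set of binding names and an object. -/
def AbsRel {X : Type*} [MulAction (NamePerm sort) X] (p q : Finset 𝒩 × X) : Prop :=
  ∃ π : NamePerm sort, permNames π p.1 = q.1 ∧ π • p.2 = q.2 ∧
    ∀ a ∈ supp sort p.2, a ∉ p.1 → π • a = a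

variable (sort) in
/-- Nominal alpha-equivalence as a setoid. -/
def absSetoid (X : Type*) [MulAction (NamePerm sort) X] : Setoid (Finset 𝒩 × X) where
  r := AbsRel (sort := sort)
  iseqv :=
    { refl := fun p => ⟨1, permNames_one _, one_smul _ _, fun a _ _ => one_smul _ _⟩
      symm := by
        rintro ⟨N, x⟩ ⟨N', x'⟩ ⟨π, h1, h2, h3⟩
        simp only at h1 h2 h3
        subst h1 h2
        refine ⟨π⁻¹, ?_, inv_smul_smul _ _, ?_⟩
        · rw [← permNames_mul, inv_mul_cancel, permNames_one]
        · intro a ha hN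
          rw [mem_supp_smul] at ha
          rw [mem_permNames] at hN
          have := h3 _ ha hN
          rw [smul_inv_smul] at this
          exact this.symm
      trans := by
        rintro ⟨N, x⟩ ⟨N', x'⟩ ⟨N'', x''⟩ ⟨π, h1, h2, h3⟩ ⟨ρ, h4, h5, h6⟩
        simp only at h1 h2 h3 h4 h5 h6
        subst h1 h2 h4 h5
        refine ⟨ρ * π, permNames_mul _ _ _, mul_smul _ _ _, ?_⟩
        intro a ha hN
        have h := h3 a ha hN
        rw [mul_smul, h]
        refine h6 a ?_ ?_
        · rw [mem_supp_smul, inv_smul_eq_iff.2 h.symm]; exact ha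
        · rw [mem_permNames, inv_smul_eq_iff.2 h.symm]; exact hN }

variable (sort) in
/-- The set of generalised name abstractions `⟨N⟩x`. -/
def Abs (X : Type*) [MulAction (NamePerm sort) X] : Type _ := Quotient (absSetoid sort X)

variable (sort) in
/-- The abstraction `⟨N⟩x`, the alpha-equivalence class of `(N, x)`. -/
def Abs.mk {X : Type*} [MulAction (NamePerm sort) X] (N : Finset 𝒩) (x : X) : Abs sort X :=
  Quotient.mk (absSetoid sort X) (N, x)

/-- `π • ⟨N⟩x = ⟨π • N⟩(π • x)`. -/
instance {X : Type*} [MulAction (NamePerm sort) X] : SMul (NamePerm sort) (Abs sort X) where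
  smul π := Quotient.map (fun p => (permNames π p.1, π • p.2)) (by
    rintro ⟨N, x⟩ ⟨N', x'⟩ ⟨ρ, h1, h2, h3⟩
    simp only at h1 h2 h3
    subst h1 h2
    refine ⟨π * ρ * π⁻¹, ?_, ?_, ?_⟩
    · simp only [← permNames_mul]; congr 1; group
    · simp only [← mul_smul]; congr 1; group
    · intro a ha hN
      rw [mem_supp_smul] at ha
      rw [mem_permNames] at hN
      rw [mul_smul, mul_smul, h3 _ ha hN, smul_inv_smul])

end Nominal

/-! ### Nominal transition systems -/

section NTS

variable {𝒩 Srt : Type*}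

/-- A nominal transition system with a silent action. -/
structure NTS (sort : 𝒩 → Srt) (States Pred Act : Type u)
    [Nominal sort States] [Nominal sort Pred] [Nominal sort Act] where
  /-- `entails P φ`: the state predicate `φ` holds in `P`. -/
  entails : States → Pred → Prop
  entails_eqvt : ∀ (π : NamePerm sort) P φ, entails P φ → entails (π • P) (π • φ)
  /-- The binding names of an action. -/
  bn : Act → Finset 𝒩
  bn_eqvt : ∀ (π : NamePerm sort) α, bn (π • α) = permNames π (bn α)
  bn_subset : ∀ α, ∀ a ∈ bn α, a ∈ supp sort α
  /-- The transition relation, between states and residuals. -/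
  trans : Set (States × Abs sort (Act × States))
  trans_eqvt : ∀ (π : NamePerm sort) P r, (P, r) ∈ trans → (π • P, π • r) ∈ trans
  trans_bn : ∀ P N α P', (P, Abs.mk sort N (α, P')) ∈ trans → bn α = N
  /-- The silent action; it has empty support. -/
  tau : Act
  tau_eqvt : ∀ π : NamePerm sort, π • tau = tau

variable {sort : 𝒩 → Srt} {States Pred Act : Type u}
  [Nominal sort States] [Nominal sort Pred] [Nominal sort Act]
  (T : NTS sort States Pred Act)

/-- `P →α P'`, that is, `(P, ⟨bn α⟩(α, P'))` is in the transition relation. -/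
def NTS.Step (α : Act) (P P' : States) : Prop :=
  (P, Abs.mk sort (T.bn α) (α, P')) ∈ T.trans

/-- `P ⇒ P'`: zero or more silent transitions. -/
def NTS.TauSteps (P P' : States) : Prop := Relation.ReflTransGen (T.Step T.tau) P P'

/-- `P ⇒α P'`: an `α`-transition preceded and followed by silent transitions. -/
def NTS.TauStep (α : Act) (P P' : States) : Prop :=
  ∃ P₁ P₂, T.TauSteps P P₁ ∧ T.Step α P₁ P₂ ∧ T.TauSteps P₂ P'

/-- The weak transition: `P ⇒ P'` if `α` is silent, and `P ⇒α P'` otherwise. -/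
def NTS.WeakStep (α : Act) (P P' : States) : Prop :=
  (α = T.tau ∧ T.TauSteps P P') ∨ (α ≠ T.tau ∧ T.TauStep α P P')

/-! ### Weak bisimilarity -/

/-- Weak simulations. -/
def NTS.IsWeakSimulation (R : States → States → Prop) : Prop :=
  ∀ P Q, R P Q → ∀ α P', Fresh sort (T.bn α) Q →
    ∃ Q', T.Step α P P' → T.WeakStep α Q Q' ∧ R P' Q'

/-- Weak static implications. -/
def NTS.IsWeakStaticImplication (R : States → States → Prop) : Prop :=
  ∀ P Q, R P Q → ∀ φ, ∃ Q', T.entails P φ → T.TauSteps Q Q' ∧ T.entails Q' φ ∧ R P Q'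

/-- Weak bisimulations. -/
def NTS.IsWeakBisimulation (R : States → States → Prop) : Prop :=
  (∀ P Q, R P Q → R Q P) ∧ T.IsWeakSimulation R ∧ T.IsWeakStaticImplication R

/-- Weak bisimilarity. -/
def NTS.WeaklyBisimilar (P Q : States) : Prop :=
  ∃ R : States → States → Prop, T.IsWeakBisimulation R ∧ R P Q

end NTS

/-! ### Raw formulas and alpha-equivalence -/

section Raw

/-- Raw formulas (not yet identified up to alpha-equivalence). Conjunctions are indexed by the
subsets of cardinality less than `κ` of a set of cardinality `κ`, which are, up to bijection, all
sets of cardinality less than `κ`. -/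
inductive Raw (κ : Cardinal.{u}) (Pred Act : Type u) : Type u
  | conj (I : Set κ.out) (hI : #I < κ) (f : I → Raw κ Pred Act) : Raw κ Pred Act
  | neg (R : Raw κ Pred Act) : Raw κ Pred Act
  | pred (φ : Pred) : Raw κ Pred Act
  | dia (α : Act) (R : Raw κ Pred Act) : Raw κ Pred Act

variable {𝒩 Srt : Type*} {sort : 𝒩 → Srt} {States Pred Act : Type u}
  [Nominal sort States] [Nominal sort Pred] [Nominal sort Act]
  {κ : Cardinal.{u}}

/-- Permutations distribute over all raw constructors. -/
def Raw.perm (π : NamePerm sort) : Raw κ Pred Act → Raw κ Pred Act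
  | .conj I hI f => .conj I hI (fun i => (f i).perm π)
  | .neg R => .neg (R.perm π)
  | .pred φ => .pred (π • φ)
  | .dia α R => .dia (π • α) (R.perm π)

instance : MulAction (NamePerm sort) (Raw κ Pred Act) where
  smul := Raw.perm
  one_smul R := by
    change Raw.perm 1 R = R
    induction R with
    | conj I hI f ih => simp only [Raw.perm, ih]
    | neg R ih => simp only [Raw.perm, ih]
    | pred φ => simp only [Raw.perm, one_smul]
    | dia α R ih => simp only [Raw.perm, one_smul, ih]
  mul_smul π ρ R := by
    change Raw.perm (π * ρ) R = Raw.perm π (Raw.perm ρ R)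
    induction R with
    | conj I hI f ih => simp only [Raw.perm, ih]
    | neg R ih => simp only [Raw.perm, ih]
    | pred φ => simp only [Raw.perm, mul_smul]
    | dia α R ih => simp only [Raw.perm, mul_smul, ih]

theorem Raw.smul_conj (π : NamePerm sort) (I : Set κ.out) (hI : #I < κ)
    (f : I → Raw κ Pred Act) : π • Raw.conj I hI f = Raw.conj I hI (fun i => π • f i) := rfl

theorem Raw.smul_neg (π : NamePerm sort) (R : Raw κ Pred Act) :
    π • Raw.neg R = Raw.neg (π • R) := rfl

theorem Raw.smul_pred (π : NamePerm sort) (φ : Pred) :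
    π • (Raw.pred φ : Raw κ Pred Act) = Raw.pred (π • φ) := rfl

theorem Raw.smul_dia (π : NamePerm sort) (α : Act) (R : Raw κ Pred Act) :
    π • Raw.dia α R = Raw.dia (π • α) (π • R) := rfl

/-- Alpha-equivalence of raw formulas. In the clause for `dia`, the second alternative for `a` says
that `a` belongs to the support of the alpha-equivalence class of `R`; and
`Alpha R (π⁻¹ • S)` amounts to `Alpha (π • R) S`, see `Raw.alpha_smul`. -/
def Raw.Alpha (T : NTS sort States Pred Act) : Raw κ Pred Act → Raw κ Pred Act → Prop
  | .conj _ _ f, .conj _ _ g =>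
      (∀ i, ∃ j, Raw.Alpha T (f i) (g j)) ∧ (∀ j, ∃ i, Raw.Alpha T (f i) (g j))
  | .neg R, .neg S => Raw.Alpha T R S
  | .pred φ, .pred ψ => φ = ψ
  | .dia α R, .dia β S => ∃ π : NamePerm sort, π • α = β ∧ Raw.Alpha T R (π⁻¹ • S) ∧
      ∀ a, (a ∈ supp sort α ∨ ∀ N : Set 𝒩, N.Finite →
          (∀ σ : NamePerm sort, (∀ ⦃b⦄, b ∈ N → σ • b = b) → Raw.Alpha T R (σ • R)) → a ∈ N) →
        a ∉ T.bn α → π • a = a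
  | _, _ => False

variable (T : NTS sort States Pred Act)

/-- The support of the alpha-equivalence class of a raw formula. -/
def Raw.asupp (R : Raw κ Pred Act) : Set 𝒩 :=
  {a | ∀ N : Set 𝒩, N.Finite →
    (∀ σ : NamePerm sort, (∀ ⦃b⦄, b ∈ N → σ • b = b) → Raw.Alpha T R (σ • R)) → a ∈ N}

theorem Raw.alpha_dia {α β : Act} {R S : Raw κ Pred Act} :
    Raw.Alpha T (.dia α R) (.dia β S) ↔ ∃ π : NamePerm sort, π • α = β ∧
      Raw.Alpha T R (π⁻¹ • S) ∧
      ∀ a, (a ∈ supp sort α ∨ a ∈ Raw.asupp T R) → a ∉ T.bn α → π • a = a := by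
  simp only [Raw.Alpha]; rfl

theorem Raw.mem_asupp_smul' (π : NamePerm sort) (R : Raw κ Pred Act)
    (h : ∀ (ρ : NamePerm sort) S, Raw.Alpha T R S → Raw.Alpha T (ρ • R) (ρ • S)) {a : 𝒩}
    (ha : a ∈ Raw.asupp T (π • R)) : π⁻¹ • a ∈ Raw.asupp T R := by
  intro N hN hs
  have := ha (π • N) hN.smul_set (fun σ hσ => by
    have h1 := hs (π⁻¹ * σ * π) fun a ha => by
      rw [mul_smul, mul_smul, hσ (Set.smul_mem_smul_set ha), inv_smul_smul]
    have h2 := h π _ h1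
    rwa [smul_smul, show π * (π⁻¹ * σ * π) = σ * π by group, mul_smul σ] at h2)
  rwa [Set.mem_smul_set_iff_inv_smul_mem] at this

theorem Raw.Alpha.smul {R S : Raw κ Pred Act} (ρ : NamePerm sort) (h : Raw.Alpha T R S) :
    Raw.Alpha T (ρ • R) (ρ • S) := by
  induction R generalizing S ρ with
  | conj I hI f ih =>
    cases S with
    | conj J hJ g =>
      obtain ⟨h1, h2⟩ := h
      exact ⟨fun i => (h1 i).imp fun j hj => ih i ρ hj, fun j => (h2 j).imp fun i hi => ih i ρ hi⟩
    | _ => exact h.elim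
  | neg R ih =>
    cases S with
    | neg S =>
      have h : Raw.Alpha T R S := h
      exact ih ρ h
    | _ => exact h.elim
  | pred φ =>
    cases S with
    | pred ψ => exact congrArg (ρ • ·) h
    | _ => exact h.elim
  | dia α R ih =>
    cases S with
    | dia β S =>
      rw [Raw.smul_dia, Raw.smul_dia, Raw.alpha_dia]
      obtain ⟨π, h1, h2, h3⟩ := (Raw.alpha_dia T).1 h
      refine ⟨ρ * π * ρ⁻¹, ?_, ?_, ?_⟩
      · rw [← h1, smul_smul, smul_smul]; congr 1; group
      · have := ih ρ h2
        rwa [smul_smul, show ρ * π⁻¹ = (ρ * π * ρ⁻¹)⁻¹ * ρ by group, mul_smul _ ρ] at this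
      · intro a ha hN
        rw [mul_smul, mul_smul, h3 (ρ⁻¹ • a), smul_inv_smul]
        · refine ha.imp (mem_supp_smul ρ).1 fun h => ?_
          exact Raw.mem_asupp_smul' T ρ R (fun ρ S => ih ρ) h
        · rwa [T.bn_eqvt, mem_permNames] at hN
    | _ => exact h.elim

theorem Raw.alpha_smul {R S : Raw κ Pred Act} (π : NamePerm sort) :
    Raw.Alpha T R (π⁻¹ • S) ↔ Raw.Alpha T (π • R) S :=
  ⟨fun h => by simpa using h.smul T π, fun h => by simpa using h.smul T π⁻¹⟩

theorem Raw.mem_asupp_smul (π : NamePerm sort) (R : Raw κ Pred Act) {a : 𝒩} :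
    a ∈ Raw.asupp T (π • R) ↔ π⁻¹ • a ∈ Raw.asupp T R := by
  refine ⟨Raw.mem_asupp_smul' T π R fun ρ S h => h.smul T ρ, fun h => ?_⟩
  have := Raw.mem_asupp_smul' (a := a) T π⁻¹ (π • R) fun ρ S h => h.smul T ρ
  have h2 := Raw.mem_asupp_smul' (a := π⁻¹ • a) T π⁻¹ (π • R) (fun ρ S h => h.smul T ρ)
    (by rwa [inv_smul_smul])
  simpa using h2

theorem Raw.Alpha.refl (R : Raw κ Pred Act) : Raw.Alpha T R R := by
  induction R with
  | conj I hI f ih => exact ⟨fun i => ⟨i, ih i⟩, fun i => ⟨i, ih i⟩⟩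
  | neg R ih => exact ih
  | pred φ => exact rfl
  | dia α R ih =>
    rw [Raw.alpha_dia]
    exact ⟨1, one_smul _ _, by simpa using ih, fun a _ _ => one_smul _ _⟩

theorem Raw.Alpha.euclid {R S U : Raw κ Pred Act} (h : Raw.Alpha T R S) (h' : Raw.Alpha T R U) :
    Raw.Alpha T S U := by
  induction R generalizing S U with
  | conj I hI f ih =>
    cases S with
    | conj J hJ g =>
      cases U with
      | conj K hK k =>
        obtain ⟨h1, h2⟩ := h
        obtain ⟨h3, h4⟩ := h'
        constructor
        · intro j
          obtain ⟨i, hi⟩ := h2 j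
          exact (h3 i).imp fun l hl => ih i hi hl
        · intro l
          obtain ⟨i, hi⟩ := h4 l
          exact (h1 i).imp fun j hj => ih i hj hi
      | _ => exact h'.elim
    | _ => exact h.elim
  | neg R ih =>
    cases S with
    | neg S =>
      cases U with
      | neg U =>
        have h : Raw.Alpha T R S := h
        have h' : Raw.Alpha T R U := h'
        exact (id (ih h h') : Raw.Alpha T S U)
      | _ => exact h'.elim
    | _ => exact h.elim
  | pred φ =>
    cases S with
    | pred ψ =>
      cases U with
      | pred χ => exact (Eq.symm h).trans h'
      | _ => exact h'.elim
    | _ => exact h.elim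
  | dia α R ih =>
    cases S with
    | dia β S =>
      cases U with
      | dia γ U =>
        obtain ⟨π, h1, h2, h3⟩ := (Raw.alpha_dia T).1 h
        obtain ⟨ρ, h4, h5, h6⟩ := (Raw.alpha_dia T).1 h'
        rw [Raw.alpha_dia]
        refine ⟨ρ * π⁻¹, ?_, ?_, ?_⟩
        · rw [← h1, mul_smul, inv_smul_smul, h4]
        · have := (ih h2 h5).smul T π
          rwa [smul_inv_smul, smul_smul, show π * ρ⁻¹ = (ρ * π⁻¹)⁻¹ by group] at this
        · intro a ha hN
          have hb : π⁻¹ • a ∉ T.bn α := by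
            rwa [← h1, T.bn_eqvt, mem_permNames] at hN
          have hs : π⁻¹ • a ∈ supp sort α ∨ π⁻¹ • a ∈ Raw.asupp T R := by
            refine ha.imp (fun h => ?_) fun h => ?_
            · rwa [← h1, mem_supp_smul] at h
            · have h7 : π⁻¹ • a ∈ Raw.asupp T (π⁻¹ • S) := by
                rw [Raw.mem_asupp_smul]; simpa using h
              intro N hN hs
              refine h7 N hN fun σ hσ => ?_
              have e1 : Raw.Alpha T R (σ⁻¹ • R) := by
                have := (ih (hs σ hσ) (Raw.Alpha.refl T R)).smul T σ⁻¹
                rwa [inv_smul_smul] at this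
              have e2 : Raw.Alpha T R (σ • π⁻¹ • S) := by
                have := (ih e1 h2).smul T σ
                rwa [smul_inv_smul] at this
              exact ih h2 e2
          have e := h3 _ hs hb
          rw [smul_inv_smul] at e
          rw [mul_smul, h6 _ hs hb, ← e]
      | _ => exact h'.elim
    | _ => exact h.elim

end Raw

/-! ### Formulas -/

section Formula

variable {𝒩 Srt : Type*} {sort : 𝒩 → Srt} {States Pred Act : Type u}
  [Nominal sort States] [Nominal sort Pred] [Nominal sort Act]
  (T : NTS sort States Pred Act) (κ : Cardinal.{u})

/-- Alpha-equivalence as a setoid. -/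
def Raw.setoid : Setoid (Raw κ Pred Act) where
  r := Raw.Alpha T
  iseqv :=
    { refl := Raw.Alpha.refl T
      symm := fun h => h.euclid T (Raw.Alpha.refl T _)
      trans := fun h h' => (h.euclid T (Raw.Alpha.refl T _)).euclid T h' }

/-- Alpha-equivalence classes of raw formulas; they need not have finite support. -/
def PreFormula : Type u := Quotient (Raw.setoid T κ)

variable {T κ}

/-- The alpha-equivalence class of a raw formula. -/
def PreFormula.mk (R : Raw κ Pred Act) : PreFormula T κ := Quotient.mk (Raw.setoid T κ) R

theorem PreFormula.mk_eq {R S : Raw κ Pred Act} :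
    (PreFormula.mk R : PreFormula T κ) = PreFormula.mk S ↔ Raw.Alpha T R S :=
  ⟨fun h => Quotient.exact h, fun h => Quotient.sound (s := Raw.setoid T κ) h⟩

theorem PreFormula.exists_rep (q : PreFormula T κ) : ∃ R, PreFormula.mk R = q :=
  Quotient.exists_rep q

instance : MulAction (NamePerm sort) (PreFormula T κ) where
  smul π := Quotient.map (π • ·) fun _ _ h => Raw.Alpha.smul T π h
  one_smul q := by
    obtain ⟨R, rfl⟩ := q.exists_rep
    exact congrArg PreFormula.mk (one_smul _ R)
  mul_smul π ρ q := by
    obtain ⟨R, rfl⟩ := q.exists_rep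
    exact congrArg PreFormula.mk (mul_smul π ρ R)

theorem PreFormula.smul_mk (π : NamePerm sort) (R : Raw κ Pred Act) :
    π • (PreFormula.mk R : PreFormula T κ) = PreFormula.mk (π • R) := rfl

theorem PreFormula.supp_mk (R : Raw κ Pred Act) :
    supp sort (PreFormula.mk R : PreFormula T κ) = Raw.asupp T R := by
  have key : ∀ N : Set 𝒩, MulAction.Supports (NamePerm sort) N (PreFormula.mk R : PreFormula T κ) ↔
      ∀ σ : NamePerm sort, (∀ ⦃b⦄, b ∈ N → σ • b = b) → Raw.Alpha T R (σ • R) := fun N =>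
    forall_congr' fun σ => imp_congr_right fun _ => by
      rw [PreFormula.smul_mk, eq_comm, PreFormula.mk_eq]
  ext a
  simp only [supp, Raw.asupp, key]

/-- A family indexed by a subset of `κ.out` that enumerates `S`. -/
theorem PreFormula.exists_family (S : Set (PreFormula T κ)) (hS : #S < κ) :
    ∃ (I : Set κ.out) (_ : #I < κ) (f : I → Raw κ Pred Act),
      Set.range (fun i => (PreFormula.mk (f i) : PreFormula T κ)) = S := by
  obtain ⟨I, ⟨e⟩⟩ : ∃ I : Set κ.out, Nonempty (I ≃ S) := by
    have : #S ≤ #κ.out := by rw [mk_out]; exact hS.le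
    obtain ⟨I, hI⟩ := le_mk_iff_exists_set.1 this
    exact ⟨I, Cardinal.eq.1 hI⟩
  refine ⟨I, by rwa [Cardinal.mk_congr e], fun i => (PreFormula.exists_rep (e i).1).choose, ?_⟩
  ext q
  constructor
  · rintro ⟨i, rfl⟩
    simp only [(PreFormula.exists_rep (e i).1).choose_spec]
    exact (e i).2
  · intro hq
    exact ⟨e.symm ⟨q, hq⟩, by simp only [(PreFormula.exists_rep _).choose_spec]; simp⟩

/-- The conjunction of a set of (classes of) formulas. -/
noncomputable def PreFormula.conj (S : Set (PreFormula T κ)) (hS : #S < κ) : PreFormula T κ :=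
  PreFormula.mk (.conj _ (exists_family S hS).choose_spec.choose
    (exists_family S hS).choose_spec.choose_spec.choose)

/-- The conjunction does not depend on how the set of conjuncts is enumerated. -/
theorem PreFormula.mk_conj (I : Set κ.out) (hI : #I < κ) (f : I → Raw κ Pred Act)
    (S : Set (PreFormula T κ)) (hS : #S < κ)
    (h : Set.range (fun i => (PreFormula.mk (f i) : PreFormula T κ)) = S) :
    PreFormula.mk (.conj I hI f) = PreFormula.conj S hS := by
  have h' := (exists_family S hS).choose_spec.choose_spec.choose_spec
  rw [PreFormula.conj, PreFormula.mk_eq]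
  constructor
  · intro i
    have hi : (PreFormula.mk (f i) : PreFormula T κ) ∈ S := h ▸ ⟨i, rfl⟩
    rw [← h'] at hi
    obtain ⟨j, hj⟩ := hi
    exact ⟨j, PreFormula.mk_eq.1 hj.symm⟩
  · intro j
    have hj : (PreFormula.mk ((exists_family S hS).choose_spec.choose_spec.choose j) :
      PreFormula T κ) ∈ S := by
        have := Set.mem_range_self (f := fun i => (PreFormula.mk
          ((exists_family S hS).choose_spec.choose_spec.choose i) : PreFormula T κ)) j
        rwa [h'] at this
    obtain ⟨i, hi⟩ := h.symm.subset hj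
    exact ⟨i, PreFormula.mk_eq.1 hi⟩

/-- Negation. -/
def PreFormula.neg : PreFormula T κ → PreFormula T κ :=
  Quotient.map Raw.neg fun _ _ h => h

/-- A state predicate as a formula. -/
def PreFormula.pred (φ : Pred) : PreFormula T κ := PreFormula.mk (.pred φ)

/-- The action modality. -/
def PreFormula.dia (α : Act) : PreFormula T κ → PreFormula T κ :=
  Quotient.map (Raw.dia α) fun R S h =>
    (Raw.alpha_dia T).2 ⟨1, one_smul _ _, by rw [inv_one, one_smul]; exact h, fun a _ _ => one_smul _ _⟩

theorem mk_smul_set_lt {X : Type u} [MulAction (NamePerm sort) X] {S : Set X} (hS : #S < κ)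
    (π : NamePerm sort) : #(π • S : Set X) < κ :=
  (mk_image_le (f := fun x => π • x) (s := S)).trans_lt hS

theorem PreFormula.smul_conj (π : NamePerm sort) (S : Set (PreFormula T κ)) (hS : #S < κ) :
    π • PreFormula.conj S hS = PreFormula.conj (π • S) (mk_smul_set_lt hS π) := by
  rw [PreFormula.conj, PreFormula.smul_mk, Raw.smul_conj]
  apply PreFormula.mk_conj
  have h' := (exists_family S hS).choose_spec.choose_spec.choose_spec
  conv_rhs => rw [← h']
  rw [← Set.image_smul, ← Set.range_comp]
  rfl

theorem PreFormula.smul_neg (π : NamePerm sort) (q : PreFormula T κ) : π • q.neg = (π • q).neg := by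
  obtain ⟨R, rfl⟩ := q.exists_rep
  rfl

theorem PreFormula.smul_pred (π : NamePerm sort) (φ : Pred) :
    π • (PreFormula.pred φ : PreFormula T κ) = PreFormula.pred (π • φ) := rfl

theorem PreFormula.smul_dia (π : NamePerm sort) (α : Act) (q : PreFormula T κ) :
    π • q.dia α = (π • q).dia (π • α) := by
  obtain ⟨R, rfl⟩ := q.exists_rep
  rfl

/-- The classes that are built up by the formula constructors, where conjunction is allowed only
for finitely supported sets of conjuncts. -/
inductive PreFormula.WellFormed : PreFormula T κ → Prop
  | conj (S : Set (PreFormula T κ)) (hS : #S < κ) (hfin : FinSupp sort S)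
      (h : ∀ q ∈ S, PreFormula.WellFormed q) : PreFormula.WellFormed (PreFormula.conj S hS)
  | neg (q : PreFormula T κ) (h : PreFormula.WellFormed q) : PreFormula.WellFormed q.neg
  | pred (φ : Pred) : PreFormula.WellFormed (PreFormula.pred φ)
  | dia (α : Act) (q : PreFormula T κ) (h : PreFormula.WellFormed q) :
      PreFormula.WellFormed (q.dia α)

theorem PreFormula.WellFormed.smul (π : NamePerm sort) {q : PreFormula T κ} (h : q.WellFormed) :
    (π • q).WellFormed := by
  induction h with
  | conj S hS hfin h ih =>
    rw [PreFormula.smul_conj]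
    refine .conj _ _ (hfin.smul π) ?_
    rintro _ ⟨q, hq, rfl⟩
    exact ih q hq
  | neg q h ih => rw [PreFormula.smul_neg]; exact .neg _ ih
  | pred φ => exact .pred _
  | dia α q h ih => rw [PreFormula.smul_dia]; exact .dia _ _ ih

variable (T κ) in
/-- The set of formulas. -/
@[ext] structure Formula : Type u where
  /-- The underlying alpha-equivalence class. -/
  val : PreFormula T κ
  wf : val.WellFormed

instance : MulAction (NamePerm sort) (Formula T κ) where
  smul π A := ⟨π • A.val, A.wf.smul π⟩
  one_smul A := Formula.ext (one_smul _ A.val)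
  mul_smul π ρ A := Formula.ext (mul_smul π ρ A.val)

theorem Formula.smul_val (π : NamePerm sort) (A : Formula T κ) :
    (π • A).val = π • A.val := rfl

theorem Formula.val_injective : Function.Injective (Formula.val : Formula T κ → PreFormula T κ) :=
  fun _ _ h => Formula.ext h

theorem Formula.smul_image_val (π : NamePerm sort) (S : Set (Formula T κ)) :
    π • (Formula.val '' S : Set (PreFormula T κ)) = Formula.val '' (π • S) := by
  simp only [← Set.image_smul, Set.image_image]
  rfl

theorem FinSupp.image_val {S : Set (Formula T κ)} (h : FinSupp sort S) :
    FinSupp sort (Formula.val '' S : Set (PreFormula T κ)) := by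
  obtain ⟨N, hN, hs⟩ := h
  exact ⟨N, hN, fun σ hσ => by rw [Formula.smul_image_val, hs σ hσ]⟩

namespace Formula

/-- The conjunction `⋀ S` of a finitely supported set `S` of fewer than `κ` formulas. -/
noncomputable def conj (S : Set (Formula T κ)) (hS : #S < κ) (hfin : FinSupp sort S) :
    Formula T κ :=
  ⟨PreFormula.conj (Formula.val '' S) (mk_image_le.trans_lt hS),
    .conj _ _ hfin.image_val (by rintro _ ⟨A, _, rfl⟩; exact A.wf)⟩

/-- Negation `¬ A`. -/
def neg (A : Formula T κ) : Formula T κ := ⟨A.val.neg, .neg _ A.wf⟩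

/-- A state predicate as a formula. -/
def pred (φ : Pred) : Formula T κ := ⟨PreFormula.pred φ, .pred φ⟩

/-- The action modality `⟨α⟩A`, in which the names in `bn α` are bound. -/
def dia (α : Act) (A : Formula T κ) : Formula T κ := ⟨A.val.dia α, .dia α _ A.wf⟩

theorem smul_neg (π : NamePerm sort) (A : Formula T κ) : π • A.neg = (π • A).neg :=
  Formula.ext (PreFormula.smul_neg π A.val)

theorem smul_pred (π : NamePerm sort) (φ : Pred) :
    π • (pred φ : Formula T κ) = pred (π • φ) := rfl

theorem smul_dia (π : NamePerm sort) (α : Act) (A : Formula T κ) :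
    π • A.dia α = (π • A).dia (π • α) :=
  Formula.ext (PreFormula.smul_dia π α A.val)

theorem smul_conj (π : NamePerm sort) (S : Set (Formula T κ)) (hS : #S < κ)
    (hfin : FinSupp sort S) :
    π • conj S hS hfin = conj (π • S) (mk_smul_set_lt hS π) (hfin.smul π) := by
  refine Formula.ext ?_
  simp only [smul_val, conj, PreFormula.smul_conj, smul_image_val]

/-- Structural induction on formulas. -/
theorem induction {p : Formula T κ → Prop}
    (conj : ∀ S hS hfin, (∀ A ∈ S, p A) → p (conj S hS hfin))
    (neg : ∀ A, p A → p A.neg) (pred : ∀ φ, p (pred φ)) (dia : ∀ α A, p A → p (A.dia α))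
    (A : Formula T κ) : p A := by
  obtain ⟨q, hq⟩ := A
  induction hq with
  | conj S hS hfin h ih =>
    have hval : Formula.val '' {A : Formula T κ | A.val ∈ S} = S := by
      ext q
      exact ⟨by rintro ⟨A, hA, rfl⟩; exact hA, fun hq => ⟨⟨q, h q hq⟩, hq, rfl⟩⟩
    have hcard : #{A : Formula T κ | A.val ∈ S} < κ := by
      rwa [← mk_image_eq Formula.val_injective, hval]
    have hf : FinSupp sort {A : Formula T κ | A.val ∈ S} := by
      obtain ⟨N, hN, hs⟩ := id hfin
      refine ⟨N, hN, fun σ hσ => ?_⟩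
      apply Set.image_injective.2 Formula.val_injective
      rw [← smul_image_val, hval, hs σ hσ]
    have := conj _ hcard hf fun A hA => ih A.1 hA
    have e : Formula.conj _ hcard hf = ⟨PreFormula.conj S hS, .conj S hS hfin h⟩ := by
      refine Formula.ext ?_
      simp only [Formula.conj, hval]
    rwa [e] at this
  | neg q h ih => exact neg ⟨q, h⟩ ih
  | pred φ => exact pred φ
  | dia α q h ih => exact dia α ⟨q, h⟩ ih

/-- Every formula has finite support, so the formulas form a nominal set. -/
theorem finSupp (A : Formula T κ) : FinSupp sort A := by
  induction A using Formula.induction with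
  | conj S hS hfin ih =>
    obtain ⟨N, hN, hs⟩ := id hfin
    refine ⟨N, hN, fun σ hσ => ?_⟩
    rw [smul_conj]
    simp only [hs σ hσ]
  | neg A ih =>
    obtain ⟨N, hN, hs⟩ := ih
    exact ⟨N, hN, fun σ hσ => by rw [smul_neg, hs σ hσ]⟩
  | pred φ =>
    obtain ⟨N, hN, hs⟩ := Nominal.finSupp (sort := sort) φ
    exact ⟨N, hN, fun σ hσ => by rw [smul_pred, hs σ hσ]⟩
  | dia α A ih =>
    obtain ⟨N, hN, hs⟩ := ih
    obtain ⟨M, hM, hs'⟩ := Nominal.finSupp (sort := sort) α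
    refine ⟨N ∪ M, hN.union hM, fun σ hσ => ?_⟩
    rw [smul_dia, hs σ fun a ha => hσ (.inl ha), hs' σ fun a ha => hσ (.inr ha)]

noncomputable instance : Nominal sort (Formula T κ) where
  finSupp := finSupp

/-- Equality of formulas `⟨α⟩A` is nominal alpha-equivalence of the pairs `(bn α, (α, A))`. -/
theorem dia_eq_dia {α β : Act} {A B : Formula T κ} :
    A.dia α = B.dia β ↔ Abs.mk sort (T.bn α) (α, A) = Abs.mk sort (T.bn β) (β, B) := by
  obtain ⟨⟨q, hq⟩, rfl⟩ : ∃ A', A' = A := ⟨A, rfl⟩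
  obtain ⟨⟨r, hr⟩, rfl⟩ : ∃ B', B' = B := ⟨B, rfl⟩
  obtain ⟨R, rfl⟩ := q.exists_rep
  obtain ⟨S, rfl⟩ := r.exists_rep
  have hsupp : ∀ a, a ∈ supp sort (⟨PreFormula.mk R, hq⟩ : Formula T κ) ↔ a ∈ Raw.asupp T R := by
    intro a
    rw [← PreFormula.supp_mk]
    refine forall_congr' fun N => imp_congr_right fun _ => imp_congr_left ?_
    exact forall_congr' fun σ => imp_congr_right fun _ =>
      ⟨fun h => congrArg Formula.val h, fun h => Formula.ext h⟩
  have h1 : Formula.dia α ⟨PreFormula.mk R, hq⟩ = Formula.dia β ⟨PreFormula.mk S, hr⟩ ↔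
      Raw.Alpha T (.dia α R) (.dia β S) :=
    ⟨fun h => PreFormula.mk_eq.1 (congrArg Formula.val h),
      fun h => Formula.ext (PreFormula.mk_eq.2 h)⟩
  have h2 : ∀ p q : Finset 𝒩 × (Act × Formula T κ),
      Abs.mk sort p.1 p.2 = Abs.mk sort q.1 q.2 ↔ AbsRel p q := fun p q =>
    ⟨fun h => Quotient.exact h, fun h => Quotient.sound (s := absSetoid sort _) h⟩
  rw [h1, Raw.alpha_dia, h2 (_, _) (_, _)]
  refine exists_congr fun π => ?_
  simp only [mem_supp_prod, hsupp, Prod.smul_mk, Prod.mk.injEq]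
  constructor
  · rintro ⟨rfl, h, h'⟩
    exact ⟨(T.bn_eqvt _ _).symm,
      ⟨rfl, Formula.ext (PreFormula.mk_eq.2 ((Raw.alpha_smul T π).1 h))⟩, h'⟩
  · rintro ⟨-, ⟨rfl, h⟩, h'⟩
    exact ⟨rfl, (Raw.alpha_smul T π).2 (PreFormula.mk_eq.1 (congrArg Formula.val h)), h'⟩

end Formula

end Formula

/-! ### Validity -/

section Validity

variable {𝒩 Srt : Type*} {sort : 𝒩 → Srt} {States Pred Act : Type u}
  [Nominal sort States] [Nominal sort Pred] [Nominal sort Act]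
  (T : NTS sort States Pred Act) {κ : Cardinal.{u}}

/-- `R.Sat T π P`: the state `P` satisfies `π • R`. In the clause for `dia`, the permutation `ρ`
turns `π • dia α R` into an alpha-variant whose binding names are fresh for `P`. -/
def Raw.Sat : Raw κ Pred Act → NamePerm sort → States → Prop
  | .conj _ _ f, π, P => ∀ i, (f i).Sat π P
  | .neg R, π, P => ¬ R.Sat π P
  | .pred φ, π, P => T.entails P (π • φ)
  | .dia α R, π, P => ∃ ρ : NamePerm sort,
      (∀ a, (a ∈ supp sort (π • α) ∨ a ∈ Raw.asupp T (π • R)) → a ∉ T.bn (π • α) → ρ • a = a) ∧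
      Fresh sort (T.bn (ρ • π • α)) P ∧
      ∃ P', T.Step (ρ • π • α) P P' ∧ R.Sat (ρ * π) P'

theorem Raw.sat_smul (R : Raw κ Pred Act) (σ π : NamePerm sort) (P : States) :
    (σ • R).Sat T π P ↔ R.Sat T (π * σ) P := by
  induction R generalizing π P with
  | conj I hI f ih => exact forall_congr' fun i => ih i π P
  | neg R ih => exact not_congr (ih π P)
  | pred φ =>
    rw [Raw.smul_pred]
    simp only [Raw.Sat, mul_smul]
  | dia α R ih =>
    rw [Raw.smul_dia]
    simp only [Raw.Sat, mul_smul, ih, mul_assoc]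

theorem Raw.Alpha.mem_asupp_iff {R S : Raw κ Pred Act} (h : Raw.Alpha T R S) (a : 𝒩) :
    a ∈ Raw.asupp T R ↔ a ∈ Raw.asupp T S := by
  rw [← PreFormula.supp_mk, ← PreFormula.supp_mk, PreFormula.mk_eq.2 h]

theorem Raw.Alpha.sat_iff {R S : Raw κ Pred Act} (h : Raw.Alpha T R S) (π : NamePerm sort)
    (P : States) : R.Sat T π P ↔ S.Sat T π P := by
  induction R generalizing S π P with
  | conj I hI f ih =>
    cases S with
    | conj J hJ g =>
      obtain ⟨h1, h2⟩ := h
      constructor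
      · intro H j
        obtain ⟨i, hi⟩ := h2 j
        exact (ih i hi π P).1 (H i)
      · intro H i
        obtain ⟨j, hj⟩ := h1 i
        exact (ih i hj π P).2 (H j)
    | _ => exact h.elim
  | neg R ih =>
    cases S with
    | neg S =>
      have h : Raw.Alpha T R S := h
      exact not_congr (ih h π P)
    | _ => exact h.elim
  | pred φ =>
    cases S with
    | pred ψ =>
      have h : φ = ψ := h
      rw [h]
    | _ => exact h.elim
  | dia α R ih =>
    cases S with
    | dia β S =>
      obtain ⟨σ, rfl, h2, h3⟩ := (Raw.alpha_dia T).1 h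
      have hF : ∀ c, ((c ∈ supp sort (σ • α) ∨ c ∈ Raw.asupp T S) ∧ c ∉ T.bn (σ • α)) ↔
          ((c ∈ supp sort α ∨ c ∈ Raw.asupp T R) ∧ c ∉ T.bn α) := by
        have e : ∀ c, ((c ∈ supp sort (σ • α) ∨ c ∈ Raw.asupp T S) ∧ c ∉ T.bn (σ • α)) ↔
            ((σ⁻¹ • c ∈ supp sort α ∨ σ⁻¹ • c ∈ Raw.asupp T R) ∧ σ⁻¹ • c ∉ T.bn α) := by
          intro c
          rw [mem_supp_smul, T.bn_eqvt, mem_permNames, h2.mem_asupp_iff T, Raw.mem_asupp_smul,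
            inv_inv, smul_inv_smul]
        intro c
        rw [e]
        constructor
        · rintro ⟨h, h'⟩
          have := h3 _ h h'
          rw [smul_inv_smul] at this
          rw [this]
          exact ⟨h, h'⟩
        · rintro ⟨h, h'⟩
          rw [inv_smul_eq_iff.2 (h3 _ h h').symm]
          exact ⟨h, h'⟩
      have hG : ∀ ρ : NamePerm sort,
          (∀ a, (a ∈ supp sort (π • α) ∨ a ∈ Raw.asupp T (π • R)) →
            a ∉ T.bn (π • α) → ρ • a = a) ↔
          (∀ a, (a ∈ supp sort (π • σ • α) ∨ a ∈ Raw.asupp T (π • S)) →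
            a ∉ T.bn (π • σ • α) → (ρ * π * σ⁻¹ * π⁻¹) • a = a) := by
        intro ρ
        refine forall_congr' fun a => ?_
        rw [← and_imp, ← and_imp, mem_supp_smul, Raw.mem_asupp_smul, T.bn_eqvt π, mem_permNames,
          mem_supp_smul π, Raw.mem_asupp_smul, T.bn_eqvt π, mem_permNames, hF]
        refine imp_congr_right fun hc => ?_
        rw [mul_smul, mul_smul, inv_smul_eq_iff.2 (h3 _ hc.1 hc.2).symm, mul_smul, smul_inv_smul]
      have hS : ∀ (ρ : NamePerm sort) (P' : States),
          R.Sat T (ρ * π) P' ↔ S.Sat T (ρ * π * σ⁻¹ * π⁻¹ * π) P' := by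
        intro ρ P'
        rw [ih h2, Raw.sat_smul, inv_mul_cancel_right]
      have hα : ∀ ρ : NamePerm sort, (ρ * π * σ⁻¹ * π⁻¹) • π • σ • α = ρ • π • α := by
        intro ρ
        simp only [mul_smul, inv_smul_smul]
      constructor
      · rintro ⟨ρ, h4, h5, P', h6, h7⟩
        refine ⟨ρ * π * σ⁻¹ * π⁻¹, (hG ρ).1 h4, ?_, P', ?_, (hS ρ P').1 h7⟩
        · rwa [hα]
        · rwa [hα]
      · rintro ⟨ρ, h4, h5, P', h6, h7⟩
        obtain ⟨ρ, rfl⟩ : ∃ ρ', ρ' * π * σ⁻¹ * π⁻¹ = ρ := ⟨ρ * π * σ * π⁻¹, by group⟩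
        rw [hα] at h5 h6
        exact ⟨ρ, (hG ρ).2 h4, h5, P', h6, (hS ρ P').2 h7⟩
    | _ => exact h.elim

/-- Validity on alpha-equivalence classes. -/
def PreFormula.Sat (P : States) : PreFormula T κ → Prop :=
  Quotient.lift (fun R => R.Sat T 1 P) fun _ _ h => propext (Raw.Alpha.sat_iff T h 1 P)

variable {T}

/-- Validity `P ⊨ A`, characterised by `sat_conj`, `sat_neg`, `sat_pred` and `sat_dia` below. -/
def Formula.Sat (P : States) (A : Formula T κ) : Prop := A.val.Sat T P

theorem Formula.sat_conj {P : States} {S : Set (Formula T κ)} {hS : #S < κ}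
    {hfin : FinSupp sort S} : (Formula.conj S hS hfin).Sat P ↔ ∀ A ∈ S, A.Sat P := by
  have hS' : #(Formula.val '' S : Set (PreFormula T κ)) < κ := mk_image_le.trans_lt hS
  have h' := (PreFormula.exists_family _ hS').choose_spec.choose_spec.choose_spec
  have : (Formula.conj S hS hfin).Sat P ↔
      ∀ q ∈ Set.range (fun i => (PreFormula.mk
        ((PreFormula.exists_family _ hS').choose_spec.choose_spec.choose i) : PreFormula T κ)),
        q.Sat T P := by
    rw [Set.forall_mem_range]
    exact Iff.rfl
  rw [this, h', Set.forall_mem_image]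
  exact Iff.rfl

theorem Formula.sat_neg {P : States} {A : Formula T κ} : A.neg.Sat P ↔ ¬ A.Sat P := by
  obtain ⟨⟨R⟩, h⟩ := A
  exact Iff.rfl

theorem Formula.sat_pred {P : States} {φ : Pred} :
    (Formula.pred φ : Formula T κ).Sat P ↔ T.entails P φ := by
  change T.entails P ((1 : NamePerm sort) • φ) ↔ _
  rw [one_smul]

/-- `P ⊨ ⟨α⟩A` if some representative `⟨β⟩B` of `⟨α⟩A` with `bn β # P` has `P →β P'` and
`P' ⊨ B` for some `P'`. -/
theorem Formula.sat_dia {P : States} {α : Act} {A : Formula T κ} :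
    (A.dia α).Sat P ↔ ∃ (β : Act) (B : Formula T κ), A.dia α = B.dia β ∧
      Fresh sort (T.bn β) P ∧ ∃ P', T.Step β P P' ∧ B.Sat P' := by
  obtain ⟨q, hq⟩ := A
  obtain ⟨R, rfl⟩ := q.exists_rep
  constructor
  · rintro ⟨ρ, h1, h2, P', h3, h4⟩
    simp only [one_smul] at h1 h2 h3
    refine ⟨ρ • α, ρ • ⟨PreFormula.mk R, hq⟩, ?_, h2, P', h3, ?_⟩
    · refine Formula.ext (PreFormula.mk_eq.2 ((Raw.alpha_dia T).2 ⟨ρ, rfl, ?_, h1⟩))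
      rw [inv_smul_smul]
      exact Raw.Alpha.refl T R
    · refine (Raw.sat_smul T R ρ 1 P').2 ?_
      rw [mul_one] at h4
      rwa [one_mul]
  · rintro ⟨β, ⟨r, hr⟩, h1, h2, P', h3, h4⟩
    obtain ⟨S, rfl⟩ := r.exists_rep
    obtain ⟨π, rfl, h5, h6⟩ := (Raw.alpha_dia T).1 (PreFormula.mk_eq.1 (congrArg Formula.val h1))
    refine ⟨π, ?_, ?_, P', ?_, ?_⟩
    · simpa only [one_smul] using h6
    · simpa only [one_smul] using h2
    · simpa only [one_smul] using h3
    · rw [h5.sat_iff, Raw.sat_smul, mul_one, mul_inv_cancel]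
      exact h4

end Validity

/-! ### Derived operators and weak formulas -/

section Weak

variable {𝒩 Srt : Type*} {sort : 𝒩 → Srt} {States Pred Act : Type u}
  [Nominal sort States] [Nominal sort Pred] [Nominal sort Act]
  {T : NTS sort States Pred Act} {κ : Cardinal.{u}}

/-- A set whose elements have a common finite support has finite support. -/
theorem finSupp_of_uniform {X : Type*} [MulAction (NamePerm sort) X] {S : Set X} {N : Set 𝒩}
    (hN : N.Finite) (h : ∀ x ∈ S, MulAction.Supports (NamePerm sort) N x) : FinSupp sort S := by
  refine ⟨N, hN, fun σ hσ => ?_⟩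
  rw [← Set.image_smul]
  exact (Set.image_congr fun x hx => h x hx σ hσ).trans (Set.image_id S)

theorem finSupp_pair {X : Type*} [MulAction (NamePerm sort) X] {x y : X}
    (hx : FinSupp sort x) (hy : FinSupp sort y) : FinSupp sort ({x, y} : Set X) := by
  obtain ⟨N, hN, hs⟩ := hx
  obtain ⟨M, hM, hs'⟩ := hy
  refine finSupp_of_uniform (hN.union hM) ?_
  rintro z (rfl | rfl)
  · exact hs.mono Set.subset_union_left
  · exact hs'.mono Set.subset_union_right

namespace Formula

theorem finSupp_neg_image {S : Set (Formula T κ)} (h : FinSupp sort S) :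
    FinSupp sort (neg '' S) := by
  obtain ⟨N, hN, hs⟩ := h
  refine ⟨N, hN, fun σ hσ => ?_⟩
  conv_rhs => rw [← hs σ hσ]
  simp only [← Set.image_smul, Set.image_image, smul_neg]

/-- The disjunction `⋁ S`, defined as `¬ ⋀ {¬ A | A ∈ S}`. -/
noncomputable def disj (S : Set (Formula T κ)) (hS : #S < κ) (hfin : FinSupp sort S) :
    Formula T κ :=
  neg (conj (neg '' S) (mk_image_le.trans_lt hS) (finSupp_neg_image hfin))

/-- The binary conjunction `A ∧ B`, that is, `⋀ {A, B}`. -/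
noncomputable def and (hκ : ℵ₀ < κ) (A B : Formula T κ) : Formula T κ :=
  conj {A, B} ((Set.toFinite _).lt_aleph0.trans hκ) (finSupp_pair A.finSupp B.finSupp)

/-- `⟨τ⟩^i A`. -/
def tauIter : ℕ → Formula T κ → Formula T κ
  | 0, A => A
  | i + 1, A => dia T.tau (tauIter i A)

theorem finSupp_tauIter (A : Formula T κ) :
    FinSupp sort (Set.range fun i => tauIter i A) := by
  obtain ⟨N, hN, hs⟩ := A.finSupp
  refine finSupp_of_uniform hN ?_
  rintro _ ⟨i, rfl⟩ σ hσ
  induction i with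
  | zero => exact hs σ hσ
  | succ i ih => exact (smul_dia _ _ _).trans (congrArg₂ dia (T.tau_eqvt σ) ih)

/-- The silent weak modality `⟨⟨τ⟩⟩A`, that is, `⋁ i, ⟨τ⟩^i A`. -/
noncomputable def weakTau (hκ : ℵ₀ < κ) (A : Formula T κ) : Formula T κ :=
  disj (Set.range fun i => tauIter i A) ((Set.countable_range _).le_aleph0.trans_lt hκ)
    (finSupp_tauIter A)

open Classical in
/-- The weak action modality: `⟨⟨α⟩⟩A` is `⟨⟨τ⟩⟩⟨α⟩⟨⟨τ⟩⟩A` for `α ≠ τ`. -/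
noncomputable def weakDia (hκ : ℵ₀ < κ) (α : Act) (A : Formula T κ) : Formula T κ :=
  if α = T.tau then weakTau hκ A else weakTau hκ (dia α (weakTau hκ A))

/-- The sublogic of weak formulas. -/
inductive IsWeak (hκ : ℵ₀ < κ) : Formula T κ → Prop
  | conj (S : Set (Formula T κ)) (hS : #S < κ) (hfin : FinSupp sort S)
      (h : ∀ A ∈ S, IsWeak hκ A) : IsWeak hκ (conj S hS hfin)
  | neg (A : Formula T κ) (h : IsWeak hκ A) : IsWeak hκ (neg A)
  | weakDia (α : Act) (A : Formula T κ) (h : IsWeak hκ A) : IsWeak hκ (weakDia hκ α A)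
  | weakTau_and_pred (A : Formula T κ) (φ : Pred) (h : IsWeak hκ A) :
      IsWeak hκ (weakTau hκ (and hκ A (pred φ)))

end Formula

/-- Weak logical equivalence: `P` and `Q` satisfy the same weak formulas. -/
def NTS.WeaklyLogicallyEquivalent (T : NTS sort States Pred Act) (hκ : ℵ₀ < κ) (P Q : States) :
    Prop :=
  ∀ A : Formula T κ, A.IsWeak hκ → (A.Sat P ↔ A.Sat Q)

end Weak

end NomHML

/-! The proof is an induction on weak formulas `A`, showing that validity of `A` passes from one
state to any weakly bisimilar state (`Invariant`, `IsWeak.invariant`). One direction suffices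
because bisimilarity is symmetric; the same symmetry settles negation.

A silent path is matched by a silent path to a bisimilar state (`exists_tauSteps`), which settles
`⟨⟨τ⟩⟩A`. For `⟨⟨τ⟩⟩(A ∧ φ)`, static implication then extends the matching path to a state that
satisfies `φ` and is still bisimilar to the original endpoint, so `A` and `φ` hold together there.

The hard case is `⟨⟨α⟩⟩A` with `α ≠ τ`. Validity supplies a representative whose bound names are
fresh for the state on the left, while simulation needs them fresh for the state on the right.
Modality and transition are therefore renamed simultaneously (`exists_step_avoiding`); this needs
spare names of every sort and finite least supports (`exists_perm_avoiding`,
`FinSupp.finite_and_supports`). The formula after the modality becomes `π • ⟨⟨τ⟩⟩A`, to which the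
induction hypothesis still applies because bisimilarity and validity are equivariant
(`NTS.WeaklyBisimilar.smul`, `Sat.smul`). Silent steps after the matching action are absorbed by the
inner `⟨⟨τ⟩⟩`. -/

namespace NomHML

/-! ### Renaming names apart, and least finite supports. -/

section Nominal

variable {𝒩 Srt : Type*} {sort : 𝒩 → Srt}

/-- The transposition of two names of the same sort. -/
noncomputable def swapPerm {a b : 𝒩} (h : sort a = sort b) : NamePerm sort := by
  classical
  refine ⟨Equiv.swap a b, fun c => ?_, (Set.toFinite {a, b}).subset fun c hc => ?_⟩
  · rw [Equiv.swap_apply_def]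
    split_ifs with h1 h2
    · rw [h1, h]
    · rw [h2, h]
    · rfl
  · by_contra hn
    simp only [Set.mem_insert_iff, Set.mem_singleton_iff, not_or] at hn
    exact hc (Equiv.swap_apply_of_ne_of_ne hn.1 hn.2)

theorem swapPerm_left {a b : 𝒩} (h : sort a = sort b) : swapPerm h • a = b := by
  classical
  exact Equiv.swap_apply_left a b

theorem swapPerm_of_ne {a b c : 𝒩} (h : sort a = sort b) (ha : c ≠ a) (hb : c ≠ b) :
    swapPerm h • c = c := by
  classical
  exact Equiv.swap_apply_of_ne_of_ne ha hb

/-- A finite set of names can be moved away from a finite set `F` by a permutation that fixes all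
other names of `F`. -/
theorem exists_perm_avoiding (hsort : ∀ a, {b | sort b = sort a}.Infinite) {S : Set 𝒩}
    (hS : S.Finite) : ∀ {F : Set 𝒩}, F.Finite →
      ∃ π : NamePerm sort, (∀ a ∈ S, π • a ∉ F) ∧ ∀ a ∈ F, a ∉ S → π • a = a := by
  induction S, hS using Set.Finite.induction_on with
  | empty => exact fun _ => ⟨1, by simp, fun a _ _ => one_smul _ a⟩
  | @insert s S hs hS ih =>
    intro F hF
    -- With `s` added to the avoided set, `π` fixes `s` and sends no name of `S` to `s`. Since `c`
    -- below is also outside `π • S`, swapping `s` and `c` afterwards leaves the images of `S`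
    -- alone.
    obtain ⟨π, h1, h2⟩ := ih (hF.insert s)
    obtain ⟨c, hc, hcn⟩ := ((hsort s).sdiff (hF.union hS.smul_set : (F ∪ π • S).Finite)).nonempty
    have hc : sort s = sort c := Eq.symm hc
    simp only [Set.mem_union, not_or] at hcn
    refine ⟨swapPerm hc * π, ?_, fun a ha hn => ?_⟩
    · rintro a (rfl | ha)
      · rw [mul_smul, h2 a (.inl rfl) hs, swapPerm_left]
        exact hcn.1
      · have h3 := h1 a ha
        rw [mul_smul, swapPerm_of_ne hc (fun e => h3 (.inl e))
          (fun e => hcn.2 (e ▸ Set.smul_mem_smul_set ha))]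
        exact fun h => h3 (.inr h)
    · rw [mul_smul, h2 a (.inr ha) fun h => hn (.inr h)]
      exact swapPerm_of_ne hc (fun e => hn (.inl e)) fun e => hcn.1 (e ▸ ha)

variable {X : Type*} [MulAction (NamePerm sort) X]

/-- Let `σ` fix `M ∩ N`. Choose `π` fixing `M` and moving `N \ M` to names that `σ` does not move.
Then `π • x = x`, so `π • N` supports `x` as well, and `σ` fixes `π • N` pointwise. -/
theorem supports_inter (hsort : ∀ a, {b | sort b = sort a}.Infinite) {x : X} {M N : Set 𝒩}
    (hM : M.Finite) (hN : N.Finite) (h : MulAction.Supports (NamePerm sort) M x)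
    (h' : MulAction.Supports (NamePerm sort) N x) :
    MulAction.Supports (NamePerm sort) (M ∩ N) x := by
  intro σ hσ
  obtain ⟨π, h1, h2⟩ := exists_perm_avoiding hsort (hN.subset Set.sdiff_subset : (N \ M).Finite)
    (hM.union σ.2.2 : (M ∪ {a | σ.1 a ≠ a}).Finite)
  have hπ : π • x = x := h π fun a ha => h2 a (.inl ha) fun hn => hn.2 ha
  have hs := supports_smul π h'
  rw [hπ] at hs
  refine hs σ ?_
  rintro _ ⟨a, ha, rfl⟩
  by_cases haM : a ∈ M
  · change σ • π • a = π • a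
    rw [h2 a (.inl haM) fun hn => hn.2 haM]
    exact hσ ⟨haM, ha⟩
  · by_contra hne
    exact h1 a ⟨ha, haM⟩ (.inr hne)

/-- A supporting set `N` of least cardinality lies inside every finite supporting set `M`, because
`N ∩ M` also supports `x` and cannot be smaller. Hence the intersection that defines `supp` is `N`
itself. -/
theorem FinSupp.finite_and_supports (hsort : ∀ a, {b | sort b = sort a}.Infinite) {x : X}
    (h : FinSupp sort x) :
    (supp sort x).Finite ∧ MulAction.Supports (NamePerm sort) (supp sort x) x := by
  obtain ⟨N, ⟨hN, hs⟩, hmin⟩ := exists_minimalFor_of_wellFoundedLT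
    (fun N : Set 𝒩 => N.Finite ∧ MulAction.Supports (NamePerm sort) N x) Set.ncard h
  have e : supp sort x = N := by
    refine Set.Subset.antisymm (fun _ ha => ha N hN hs) fun a ha M hM hs' => ?_
    have hle := hmin ⟨hN.inter_of_left M, supports_inter hsort hN hM hs hs'⟩
      (Set.ncard_le_ncard Set.inter_subset_left hN)
    have := Set.eq_of_subset_of_ncard_le Set.inter_subset_left hle hN
    exact (this.symm.subset ha).2
  rw [e]
  exact ⟨hN, hs⟩

theorem Abs.mk_eq_mk {N M : Finset 𝒩} {x y : X} :
    Abs.mk sort N x = Abs.mk sort M y ↔ AbsRel (sort := sort) (N, x) (M, y) :=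
  ⟨fun h => Quotient.exact h, fun h => Quotient.sound (s := absSetoid sort X) h⟩

theorem Abs.mk_perm (π : NamePerm sort) {N : Finset 𝒩} {x : X}
    (h : ∀ a ∈ supp sort x, a ∉ N → π • a = a) :
    Abs.mk sort (permNames π N) (π • x) = Abs.mk sort N x :=
  (Abs.mk_eq_mk.2 ⟨π, rfl, rfl, h⟩).symm

theorem Fresh.smul (π : NamePerm sort) {N : Finset 𝒩} {x : X} (h : Fresh sort N x) :
    Fresh sort (permNames π N) (π • x) := fun a ha hx =>
  h _ (mem_permNames.1 ha) ((mem_supp_smul π).1 hx)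

end Nominal

/-! ### Equivariance of transitions and of weak bisimilarity; matching of silent paths. -/

section NTS

variable {𝒩 Srt : Type*} {sort : 𝒩 → Srt} {States Pred Act : Type u}
  [Nominal sort States] [Nominal sort Pred] [Nominal sort Act]
  {T : NTS sort States Pred Act}

theorem NTS.bn_tau : T.bn T.tau = ∅ :=
  Finset.eq_empty_of_forall_notMem fun a ha =>
    T.bn_subset _ a ha ∅ Set.finite_empty fun σ _ => T.tau_eqvt σ

theorem NTS.smul_eq_tau {π : NamePerm sort} {α : Act} : π • α = T.tau ↔ α = T.tau := by
  rw [smul_eq_iff_eq_inv_smul, T.tau_eqvt]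

theorem NTS.Step.smul (π : NamePerm sort) {α : Act} {P P' : States} (h : T.Step α P P') :
    T.Step (π • α) (π • P) (π • P') := by
  have := T.trans_eqvt π _ _ h
  rw [NTS.Step, T.bn_eqvt]
  exact this

theorem NTS.TauSteps.smul (π : NamePerm sort) {P P' : States} (h : T.TauSteps P P') :
    T.TauSteps (π • P) (π • P') :=
  h.lift (π • ·) fun _ _ hs => by simpa only [T.tau_eqvt] using hs.smul π

theorem NTS.WeakStep.smul (π : NamePerm sort) {α : Act} {P P' : States}
    (h : T.WeakStep α P P') : T.WeakStep (π • α) (π • P) (π • P') := by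
  rcases h with ⟨h, h'⟩ | ⟨h, P₁, P₂, h1, h2, h3⟩
  · exact .inl ⟨smul_eq_tau.2 h, h'.smul π⟩
  · exact .inr ⟨mt smul_eq_tau.1 h, π • P₁, π • P₂, h1.smul π, h2.smul π, h3.smul π⟩

theorem NTS.entails_smul (π : NamePerm sort) {P : States} {φ : Pred} :
    T.entails (π • P) (π • φ) ↔ T.entails P φ :=
  ⟨fun h => by simpa only [inv_smul_smul] using T.entails_eqvt π⁻¹ _ _ h, T.entails_eqvt π P φ⟩

namespace NTS.WeaklyBisimilar

variable {P Q : States}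

theorem symm (h : T.WeaklyBisimilar P Q) : T.WeaklyBisimilar Q P :=
  let ⟨R, hR, hPQ⟩ := h
  ⟨R, hR, hR.1 _ _ hPQ⟩

theorem exists_weakStep (h : T.WeaklyBisimilar P Q) {α : Act} {P' : States}
    (hα : Fresh sort (T.bn α) Q) (hs : T.Step α P P') :
    ∃ Q', T.WeakStep α Q Q' ∧ T.WeaklyBisimilar P' Q' :=
  let ⟨R, hR, hPQ⟩ := h
  let ⟨Q', hQ'⟩ := hR.2.1 P Q hPQ α P' hα
  ⟨Q', (hQ' hs).1, R, hR, (hQ' hs).2⟩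

theorem exists_entails (h : T.WeaklyBisimilar P Q) {φ : Pred} (hφ : T.entails P φ) :
    ∃ Q', T.TauSteps Q Q' ∧ T.entails Q' φ ∧ T.WeaklyBisimilar P Q' :=
  let ⟨R, hR, hPQ⟩ := h
  let ⟨Q', hQ'⟩ := hR.2.2 P Q hPQ φ
  ⟨Q', (hQ' hφ).1, (hQ' hφ).2.1, R, hR, (hQ' hφ).2.2⟩

/-- A silent action binds no names, so the freshness side condition is vacuous and silent steps can
be matched one at a time. -/
theorem exists_tauSteps (h : T.WeaklyBisimilar P Q) {P' : States} (hs : T.TauSteps P P') :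
    ∃ Q', T.TauSteps Q Q' ∧ T.WeaklyBisimilar P' Q' := by
  induction hs with
  | refl => exact ⟨Q, .refl, h⟩
  | tail _ hs ih =>
    obtain ⟨Q₁, h1, h2⟩ := ih
    obtain ⟨Q₂, h3, h4⟩ := h2.exists_weakStep (by simp [Fresh, bn_tau]) hs
    rcases h3 with ⟨-, h3⟩ | ⟨h3, -⟩
    · exact ⟨Q₂, Relation.ReflTransGen.trans h1 h3, h4⟩
    · exact (h3 rfl).elim

/-- Bisimilarity transported along `π` is again a weak bisimulation: challenges are moved back by
`π⁻¹`, answered there, and the answers moved forward by `π`. -/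
theorem smul (π : NamePerm sort) (h : T.WeaklyBisimilar P Q) :
    T.WeaklyBisimilar (π • P) (π • Q) := by
  refine ⟨fun P Q => T.WeaklyBisimilar (π⁻¹ • P) (π⁻¹ • Q), ⟨fun _ _ => symm, ?_, ?_⟩, ?_⟩
  · intro P Q hPQ α P' hα
    by_cases hs : T.Step α P P'
    · have hα' := hα.smul π⁻¹
      rw [← T.bn_eqvt] at hα'
      obtain ⟨Q', h1, h2⟩ := hPQ.exists_weakStep hα' (hs.smul π⁻¹)
      refine ⟨π • Q', fun _ => ⟨?_, ?_⟩⟩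
      · simpa only [smul_inv_smul] using h1.smul π
      · simpa only [inv_smul_smul] using h2
    -- The simulation clause puts the existential outside the implication, so a witness is due even
    -- without a transition; any state serves.
    · exact ⟨Q, fun h => (hs h).elim⟩
  · intro P Q hPQ φ
    by_cases hφ : T.entails P φ
    · obtain ⟨Q', h1, h2, h3⟩ := hPQ.exists_entails (T.entails_eqvt π⁻¹ _ _ hφ)
      refine ⟨π • Q', fun _ => ⟨?_, ?_, ?_⟩⟩
      · simpa only [smul_inv_smul] using h1.smul π
      · simpa only [smul_inv_smul] using T.entails_eqvt π _ _ h2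
      · simpa only [inv_smul_smul] using h3
    · exact ⟨Q, fun h => (hφ h).elim⟩
  · simpa only [inv_smul_smul] using h

end NTS.WeaklyBisimilar

end NTS

/-! ### Equivariance of validity, and truth conditions of the modalities. -/

section Formula

variable {𝒩 Srt : Type*} {sort : 𝒩 → Srt} {States Pred Act : Type u}
  [Nominal sort States] [Nominal sort Pred] [Nominal sort Act]
  {T : NTS sort States Pred Act} {κ : Cardinal.{u}}

namespace Formula

theorem Sat.smul (π : NamePerm sort) {A : Formula T κ} {P : States} :
    (π • A).Sat (π • P) ↔ A.Sat P := by
  induction A using Formula.induction generalizing π P with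
  | conj S hS hfin ih =>
    rw [smul_conj, sat_conj, sat_conj, ← Set.image_smul, Set.forall_mem_image]
    exact forall₂_congr fun A hA => ih A hA π
  | neg A ih => rw [smul_neg, sat_neg, sat_neg, ih]
  | pred φ => rw [smul_pred, sat_pred, sat_pred, T.entails_smul]
  | dia α A ih =>
    -- One direction is proved for arbitrary `π` and `A`; the converse is its instance at `π⁻¹` and
    -- `π • A`.
    have key : ∀ (π : NamePerm sort) {A : Formula T κ} {P : States} {α : Act},
        (∀ (π : NamePerm sort) {P : States}, (π • A).Sat (π • P) ↔ A.Sat P) →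
        (A.dia α).Sat P → (π • A.dia α).Sat (π • P) := by
      intro π A P α ih h
      obtain ⟨β, B, h1, h2, P', h3, h4⟩ := sat_dia.1 h
      obtain ⟨ρ, -, h5, -⟩ := Abs.mk_eq_mk.1 (dia_eq_dia.1 h1)
      -- The body `B` of a representative is a renaming of `A`, so the induction hypothesis, which
      -- covers all permutations, reaches it through `A` at `ρ⁻¹ • P'`.
      obtain rfl : ρ • A = B := congrArg Prod.snd h5
      rw [smul_dia]
      refine sat_dia.2 ⟨π • β, π • ρ • A, ?_, ?_, π • P', h3.smul π, ?_⟩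
      · rw [← smul_dia, h1, smul_dia]
      · rw [T.bn_eqvt]
        exact h2.smul π
      · have : (ρ • A).Sat (ρ • ρ⁻¹ • P') := by rwa [smul_inv_smul]
        rw [smul_smul]
        have h6 := (ih (π * ρ)).2 ((ih ρ).1 this)
        rwa [mul_smul π ρ (ρ⁻¹ • P'), smul_inv_smul] at h6
    refine ⟨fun h => ?_, key π ih⟩
    rw [smul_dia] at h
    have := key π⁻¹ (A := π • A) (fun σ P => ?_) h
    · rwa [← smul_dia, inv_smul_smul, inv_smul_smul] at this
    · have e := ih (σ * π) (P := π⁻¹ • P)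
      have e' := ih π (P := π⁻¹ • P)
      rw [mul_smul σ π (π⁻¹ • P), smul_inv_smul] at e
      rw [smul_inv_smul] at e'
      rw [smul_smul]
      exact e.trans e'.symm

theorem sat_smul_iff {π : NamePerm sort} {A : Formula T κ} {P : States} :
    (π • A).Sat P ↔ A.Sat (π⁻¹ • P) := by
  rw [← Sat.smul π (A := A), smul_inv_smul]

theorem exists_smul_of_dia_eq_dia {α β : Act} {A B : Formula T κ} (h : A.dia α = B.dia β) :
    ∃ π : NamePerm sort, π • α = β ∧ π • A = B ∧
      ∀ a ∈ supp sort (α, A), a ∉ T.bn α → π • a = a :=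
  let ⟨π, _, h1, h2⟩ := Abs.mk_eq_mk.1 (dia_eq_dia.1 h)
  ⟨π, congrArg Prod.fst h1, congrArg Prod.snd h1, h2⟩

/-- The bound names of a modality and of a matching transition can be chosen outside any finite
set of names. -/
theorem exists_step_avoiding (hsort : ∀ a, {b | sort b = sort a}.Infinite) {F : Set 𝒩}
    (hF : F.Finite) {β : Act} {B : Formula T κ} {P P' : States} (hs : T.Step β P P')
    (hB : B.Sat P') :
    ∃ (γ : Act) (C : Formula T κ), B.dia β = C.dia γ ∧ (∀ a ∈ T.bn γ, a ∉ F) ∧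
      ∃ P'', T.Step γ P P'' ∧ C.Sat P'' := by
  have hfin : (supp sort β ∪ supp sort B ∪ supp sort P').Finite :=
    (((Nominal.finSupp β).finite_and_supports hsort).1.union
      (B.finSupp.finite_and_supports hsort).1).union
      ((Nominal.finSupp P').finite_and_supports hsort).1
  -- Including the supports of `β`, `B` and `P'` in the avoided set makes `π` fix all their names
  -- outside `bn β`. The same `π` is then an alpha-conversion of both the modality and the residual.
  obtain ⟨π, h1, h2⟩ := exists_perm_avoiding hsort (T.bn β).finite_toSet (hF.union hfin)
  refine ⟨π • β, π • B, ?_, ?_, π • P', ?_, (Sat.smul π).2 hB⟩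
  · rw [dia_eq_dia, T.bn_eqvt]
    refine (Abs.mk_perm π (x := (β, B)) fun a ha hn => h2 a (.inr (.inl ?_)) hn).symm
    exact mem_supp_prod.1 ha
  · intro a ha haF
    rw [T.bn_eqvt, mem_permNames] at ha
    exact h1 _ ha (.inl (by rwa [smul_inv_smul]))
  · rw [NTS.Step, T.bn_eqvt]
    have := Abs.mk_perm π (N := T.bn β) (x := (β, P')) fun a ha hn => h2 a (.inr ?_) hn
    · rw [Prod.smul_mk] at this
      rw [this]
      exact hs
    · exact (mem_supp_prod.1 ha).imp .inl id

/-- Freshness of the bound names for `P` costs nothing, since they can be renamed away from `supp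
P`. -/
theorem sat_dia_of_step (hsort : ∀ a, {b | sort b = sort a}.Infinite) {β : Act}
    {B : Formula T κ} {P P' : States} (hs : T.Step β P P') (hB : B.Sat P') :
    (B.dia β).Sat P := by
  obtain ⟨γ, C, h1, h2, h3⟩ := exists_step_avoiding hsort
    ((Nominal.finSupp P).finite_and_supports hsort).1 hs hB
  exact sat_dia.2 ⟨γ, C, h1, h2, h3⟩

/-- As `bn τ` is empty, an alpha-conversion of `⟨τ⟩A` fixes `supp A` pointwise and hence fixes `A`:
there is only one representative. -/
theorem sat_dia_tau (hsort : ∀ a, {b | sort b = sort a}.Infinite) {A : Formula T κ}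
    {P : States} : (A.dia T.tau).Sat P ↔ ∃ P', T.Step T.tau P P' ∧ A.Sat P' := by
  refine ⟨fun h => ?_, fun ⟨P', h1, h2⟩ => sat_dia_of_step hsort h1 h2⟩
  obtain ⟨β, B, h1, -, P', h3, h4⟩ := sat_dia.1 h
  obtain ⟨π, rfl, rfl, h5⟩ := exists_smul_of_dia_eq_dia h1
  rw [T.tau_eqvt] at h3
  rw [(A.finSupp.finite_and_supports hsort).2 π fun a ha =>
    h5 a (mem_supp_prod.2 (.inr ha)) (by simp [NTS.bn_tau])] at h4
  exact ⟨P', h3, h4⟩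

theorem sat_disj {S : Set (Formula T κ)} {hS : #S < κ} {hfin : FinSupp sort S} {P : States} :
    (disj S hS hfin).Sat P ↔ ∃ A ∈ S, A.Sat P := by
  rw [disj, sat_neg, sat_conj, Set.forall_mem_image]
  simp only [sat_neg, not_forall, not_not, exists_prop]

theorem sat_and {hκ : ℵ₀ < κ} {A B : Formula T κ} {P : States} :
    (A.and hκ B).Sat P ↔ A.Sat P ∧ B.Sat P := by
  rw [Formula.and, sat_conj]
  simp

theorem sat_weakTau (hsort : ∀ a, {b | sort b = sort a}.Infinite) {hκ : ℵ₀ < κ}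
    {A : Formula T κ} {P : States} :
    (weakTau hκ A).Sat P ↔ ∃ P', T.TauSteps P P' ∧ A.Sat P' := by
  rw [weakTau, sat_disj, Set.exists_range_iff]
  constructor
  · rintro ⟨i, hi⟩
    induction i generalizing P with
    | zero => exact ⟨P, .refl, hi⟩
    | succ i ih =>
      obtain ⟨P₁, h1, h2⟩ := (sat_dia_tau hsort).1 hi
      obtain ⟨P', h3, h4⟩ := ih h2
      exact ⟨P', .head h1 h3, h4⟩
  · rintro ⟨P', h, hA⟩
    induction h using Relation.ReflTransGen.head_induction_on with
    | refl => exact ⟨0, hA⟩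
    | head h1 _ ih =>
      obtain ⟨i, hi⟩ := ih
      exact ⟨i + 1, (sat_dia_tau hsort).2 ⟨_, h1, hi⟩⟩

/-- Silent paths are equivariant, so `π` passes through the modality at the level of validity, with
no need to move it through the disjunction. -/
theorem sat_smul_weakTau (hsort : ∀ a, {b | sort b = sort a}.Infinite) {hκ : ℵ₀ < κ}
    {π : NamePerm sort} {A : Formula T κ} {P : States} :
    (π • weakTau hκ A).Sat P ↔ ∃ P', T.TauSteps P P' ∧ (π • A).Sat P' := by
  rw [sat_smul_iff, sat_weakTau hsort]
  constructor
  · rintro ⟨P', h1, h2⟩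
    exact ⟨π • P', by simpa only [smul_inv_smul] using h1.smul π, (Sat.smul π).2 h2⟩
  · rintro ⟨P', h1, h2⟩
    exact ⟨π⁻¹ • P', h1.smul π⁻¹, sat_smul_iff.1 h2⟩

/-! ### Invariance of weak formulas under weak bisimilarity. -/

/-- Validity of `A` is preserved by weak bisimilarity. -/
def Invariant (A : Formula T κ) : Prop :=
  ∀ ⦃P Q⦄, T.WeaklyBisimilar P Q → A.Sat P → A.Sat Q

theorem Invariant.smul {A : Formula T κ} (h : A.Invariant) (π : NamePerm sort) :
    (π • A).Invariant := fun _ _ hPQ hP =>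
  sat_smul_iff.2 (h (hPQ.smul π⁻¹) (sat_smul_iff.1 hP))

theorem Invariant.weakTau (hsort : ∀ a, {b | sort b = sort a}.Infinite) {hκ : ℵ₀ < κ}
    {A : Formula T κ} (h : A.Invariant) : (weakTau hκ A).Invariant := by
  intro P Q hPQ hP
  obtain ⟨P', h1, h2⟩ := (sat_weakTau hsort).1 hP
  obtain ⟨Q', h3, h4⟩ := hPQ.exists_tauSteps h1
  exact (sat_weakTau hsort).2 ⟨Q', h3, h h4 h2⟩

theorem Invariant.weakTau_and_pred (hsort : ∀ a, {b | sort b = sort a}.Infinite) {hκ : ℵ₀ < κ}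
    {A : Formula T κ} (h : A.Invariant) (φ : Pred) :
    (Formula.weakTau hκ (A.and hκ (pred φ))).Invariant := by
  intro P Q hPQ hP
  obtain ⟨P', h1, h2⟩ := (sat_weakTau hsort).1 hP
  rw [sat_and, sat_pred] at h2
  obtain ⟨Q₁, h3, h4⟩ := hPQ.exists_tauSteps h1
  -- The state `Q₂` is bisimilar to `P'` itself, so `A` transfers to the very state where `φ` holds.
  obtain ⟨Q₂, h5, h6, h7⟩ := h4.exists_entails h2.2
  exact (sat_weakTau hsort).2 ⟨Q₂, Relation.ReflTransGen.trans h3 h5,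
    sat_and.2 ⟨h h7 h2.1, sat_pred.2 h6⟩⟩

theorem Invariant.weakDia (hsort : ∀ a, {b | sort b = sort a}.Infinite) {hκ : ℵ₀ < κ}
    {A : Formula T κ} (h : A.Invariant) (α : Act) : (weakDia hκ α A).Invariant := by
  rw [Formula.weakDia]
  split_ifs with hα
  · exact h.weakTau hsort
  intro P Q hPQ hP
  obtain ⟨P₁, h1, h2⟩ := (sat_weakTau hsort).1 hP
  obtain ⟨Q₁, h3, h4⟩ := hPQ.exists_tauSteps h1
  obtain ⟨β, B, h5, -, P', h6, h7⟩ := sat_dia.1 h2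
  -- The names of `bn β` may occur in `Q₁`; `γ` and `C` are a renaming fit for the simulation
  -- clause.
  obtain ⟨γ, C, h8, h9, P₂, h10, h11⟩ := exists_step_avoiding hsort
    ((Nominal.finSupp Q₁).finite_and_supports hsort).1 h6 h7
  rw [h8] at h5
  obtain ⟨π, rfl, rfl, -⟩ := exists_smul_of_dia_eq_dia h5
  obtain ⟨Q₂, h12, h13⟩ := h4.exists_weakStep h9 h10
  rcases h12 with ⟨h12, -⟩ | ⟨-, Q₃, Q₄, h14, h15, h16⟩
  · exact (hα (NTS.smul_eq_tau.1 h12)).elim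
  -- Unfolding the modality at `Q₂` lets the trailing path from `Q₄` to `Q₂` be prefixed to it, so
  -- that `π • ⟨⟨τ⟩⟩A` already holds at `Q₄`.
  obtain ⟨Q₅, h17, h18⟩ := (sat_smul_weakTau hsort).1 ((h.weakTau hsort).smul π h13 h11)
  refine (sat_weakTau hsort).2 ⟨Q₃, Relation.ReflTransGen.trans h3 h14, ?_⟩
  rw [h5]
  -- The bound names were made fresh for `Q₁`, not for `Q₃`; the lemma used here requires no
  -- freshness.
  exact sat_dia_of_step hsort h15
    ((sat_smul_weakTau hsort).2 ⟨Q₅, Relation.ReflTransGen.trans h16 h17, h18⟩)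

theorem IsWeak.invariant (hsort : ∀ a, {b | sort b = sort a}.Infinite) {hκ : ℵ₀ < κ}
    {A : Formula T κ} (hA : A.IsWeak hκ) : A.Invariant := by
  induction hA with
  | conj S hS hfin _ ih =>
    exact fun P Q hPQ hP => sat_conj.2 fun A hA => ih A hA hPQ (sat_conj.1 hP A hA)
  | neg A _ ih =>
    exact fun P Q hPQ hP => sat_neg.2 fun hQ => sat_neg.1 hP (ih hPQ.symm hQ)
  | weakDia α A _ ih => exact ih.weakDia hsort α
  | weakTau_and_pred A φ _ ih => exact ih.weakTau_and_pred hsort φ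

end Formula

end Formula

end NomHML

theorem mainTheorem6 {𝒩 Srt : Type*} [Countable 𝒩] [Infinite 𝒩] (sort : 𝒩 → Srt)
    (hsort : ∀ a, {b | sort b = sort a}.Infinite)
    {States Pred Act : Type u}
    [NomHML.Nominal sort States] [NomHML.Nominal sort Pred] [NomHML.Nominal sort Act]
    (T : NomHML.NTS sort States Pred Act)
    (κ : Cardinal.{u}) (hκ : ℵ₀ < κ) (hStates : #States < κ) (P Q : States)
    (h : T.WeaklyBisimilar P Q) :
    T.WeaklyLogicallyEquivalent hκ P Q :=
  fun _ hA => ⟨fun hP => hA.invariant hsort h hP, fun hQ => hA.invariant hsort h.symm hQ⟩
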